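/- Let $K$ be a field, $L/K$ a cyclic Galois extension of degree $n$, and $\sigma$ a generator of $\mathrm{Gal}(L/K)$. Let $R=L[x;\sigma]$ be the skew polynomial ring, with $xa=\sigma(a)x$ for $a\in L$. Let $F\in K[y]$ be monic and irreducible of degree $s$, put $E_F=K[y]/(F(y))$ and $R_F=R/RF(x^n)$, and regard $R_F$ as an $E_F$-algebra by letting $y$ act as $x^n$. (i) If $K$ is finite and $F\neq y$, then $R_F\cong M_n(E_F)$ as $E_F$-algebras. (ii) Let $K$ be arbitrary. Every $a\in R$ has a greatest common right divisor $\mathrm{gcrd}(a,F(x^n))$ with $F(x^n)$ in $R$ (a common right divisor that every common right divisor divides on the right). If $e:R_F\to M_n(E_F)$ is any isomorphism of $E_F$-algebras, then the rank of $a$ as an element of $M_n(E_F)$, that is, the rank of the matrix $e(a+RF(x^n))$, is $$\mathrm{rank}(a)=n-\frac1s\deg\bigl(\mathrm{gcrd}(a,F(x^n))\bigr)$$ for any choice of the greatest common right divisor. -/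

import Mathlib

noncomputable section

namespace SkewRank

open Polynomial

variable {K L : Type*} [Field K] [Field L] [Algebra K L]

/-- A copy of the field `L` that remembers the automorphism `σ`, so that Mathlib's skew
polynomials over it are `L[x; σ]`. -/
def Twist (_σ : L ≃ₐ[K] L) : Type _ := L

instance (σ : L ≃ₐ[K] L) : Field (Twist σ) := inferInstanceAs (Field L)

instance (σ : L ≃ₐ[K] L) : Algebra K (Twist σ) := inferInstanceAs (Algebra K L)

/-- The natural number `m` acts on `L` as `σ ^ m`. -/
instance (σ : L ≃ₐ[K] L) : MulSemiringAction (Multiplicative ℕ) (Twist σ) where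
  smul m a := (σ ^ m.toAdd : L ≃ₐ[K] L) a
  one_smul _ := rfl
  mul_smul m k a := by
    change (σ ^ (m.toAdd + k.toAdd) : L ≃ₐ[K] L) a = _
    rw [pow_add]
    rfl
  smul_zero m := map_zero (σ ^ m.toAdd : L ≃ₐ[K] L)
  smul_add m := map_add (σ ^ m.toAdd : L ≃ₐ[K] L)
  smul_one m := map_one (σ ^ m.toAdd : L ≃ₐ[K] L)
  smul_mul m := map_mul (σ ^ m.toAdd : L ≃ₐ[K] L)

theorem smul_def (σ : L ≃ₐ[K] L) (m : Multiplicative ℕ) (a : Twist σ) :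
    m • a = (σ ^ m.toAdd : L ≃ₐ[K] L) a := rfl

instance (σ : L ≃ₐ[K] L) : SMulCommClass (Multiplicative ℕ) K (Twist σ) where
  smul_comm m c a := map_smul (σ ^ m.toAdd : L ≃ₐ[K] L) c a

/-- The skew polynomial ring `R = L[x; σ]`, in which `x * a = σ a * x` for `a` in `L`. -/
abbrev SkewPoly (σ : L ≃ₐ[K] L) : Type _ := SkewPolynomial (Twist σ)

/-- The degree of a skew polynomial (`0` for the zero polynomial). -/
def natDegree {σ : L ≃ₐ[K] L} (p : SkewPoly σ) : ℕ := p.support.sup id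

/-- `g` is a greatest common right divisor of `a` and `b` (such a `g` is unique up to
multiplication on the left by a nonzero constant, so its degree is determined). -/
def IsGCRD {σ : L ≃ₐ[K] L} (g a b : SkewPoly σ) : Prop :=
  (∃ c, a = c * g) ∧ (∃ d, b = d * g) ∧
    ∀ h : SkewPoly σ, (∃ c, a = c * h) → (∃ d, b = d * h) → ∃ e, g = e * h

/-- The skew polynomial `F(x^n)`, where `n` is the order of `σ`. -/
def central (σ : L ≃ₐ[K] L) (F : K[X]) : SkewPoly σ :=
  aeval ((SkewPolynomial.X : SkewPoly σ) ^ orderOf σ) F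

theorem X_pow_comm (σ : L ≃ₐ[K] L) (p : SkewPoly σ) :
    Commute ((SkewPolynomial.X : SkewPoly σ) ^ orderOf σ) p := by
  have h : ∀ b : Twist σ, (SkewPolynomial.φ^[orderOf σ]) b = b := fun b => by
    rw [SkewPolynomial.φ_iterate_apply, smul_def, toAdd_ofAdd, pow_orderOf_eq_one]
    rfl
  rw [Commute, SemiconjBy, SkewPolynomial.X_pow_mul]
  simp only [h, SkewPolynomial.sum_monomial]

theorem central_comm (σ : L ≃ₐ[K] L) (F : K[X]) (p : SkewPoly σ) :
    Commute (central σ F) p := by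
  unfold central
  induction F using Polynomial.induction_on' with
  | add f g hf hg => rw [map_add]; exact hf.add_left hg
  | monomial m c =>
    rw [aeval_monomial]
    exact Commute.mul_left (Algebra.commutes c p) ((X_pow_comm σ p).pow_left m)

/-- The left ideal `R F(x^n)` is two-sided. -/
instance (σ : L ≃ₐ[K] L) (F : K[X]) :
    (Ideal.span {central σ F} : Ideal (SkewPoly σ)).IsTwoSided where
  mul_mem_of_left {a} b ha := by
    obtain ⟨c, rfl⟩ := Ideal.mem_span_singleton'.1 ha
    rw [mul_assoc, (central_comm σ F b).eq, ← mul_assoc]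
    exact Ideal.mul_mem_left _ _ (Ideal.mem_span_singleton_self _)

/-- The quotient ring `R_F = R / R F(x^n)`. -/
def RF (σ : L ≃ₐ[K] L) (F : K[X]) : Type _ :=
  SkewPoly σ ⧸ (Ideal.span {central σ F} : Ideal (SkewPoly σ))

instance (σ : L ≃ₐ[K] L) (F : K[X]) : Ring (RF σ F) :=
  inferInstanceAs (Ring (SkewPoly σ ⧸ (Ideal.span {central σ F} : Ideal (SkewPoly σ))))

/-- The residue map `R → R_F`. -/
def RF.mk (σ : L ≃ₐ[K] L) (F : K[X]) : SkewPoly σ →+* RF σ F :=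
  Ideal.Quotient.mk (Ideal.span {central σ F} : Ideal (SkewPoly σ))

/-- The map `E_F = K[y]/(F) → R_F` that sends the class of `G(y)` to the class of `G(x^n)`. -/
def centreMap (σ : L ≃ₐ[K] L) (F : K[X]) : AdjoinRoot F →+* RF σ F :=
  Ideal.Quotient.lift (Ideal.span {F})
    ((RF.mk σ F).comp
      (aeval ((SkewPolynomial.X : SkewPoly σ) ^ orderOf σ) : K[X] →ₐ[K] SkewPoly σ).toRingHom)
    (fun G hG => by
      obtain ⟨H, rfl⟩ := Ideal.mem_span_singleton'.1 hG
      have h : RF.mk σ F (central σ F) = 0 :=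
        Ideal.Quotient.eq_zero_iff_mem.2 (Ideal.mem_span_singleton_self _)
      change RF.mk σ F (aeval _ (H * F)) = 0
      rw [map_mul, map_mul]
      change _ * RF.mk σ F (central σ F) = 0
      rw [h, mul_zero])

/-- `R_F` is an algebra over `E_F = K[y]/(F)`, with `y` acting as `x^n`. -/
instance (σ : L ≃ₐ[K] L) (F : K[X]) : Algebra (AdjoinRoot F) (RF σ F) :=
  (centreMap σ F).toAlgebra' (fun c r => by
    obtain ⟨G, rfl⟩ := Ideal.Quotient.mk_surjective c
    obtain ⟨p, rfl⟩ := Ideal.Quotient.mk_surjective r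
    change RF.mk σ F (central σ G) * RF.mk σ F p = RF.mk σ F p * RF.mk σ F (central σ G)
    rw [← map_mul, (central_comm σ G p).eq, map_mul])

end SkewRank

end

/-!
Write `R = L[x; σ]`, with centre `K[xⁿ]`.

For (i), let `b` have nonzero constant term and let `p`, of degree at most `deg b`, be central
modulo the left ideal `R b`. The commutators of `p` with constants and with `x` lie in `R b` and
have zero constant term; if they also have degree at most `deg b`, they vanish, so `p` is itself
central. As `F(0) ≠ 0`, this applies to the remainders modulo `F(xⁿ)`, so that `R_F` has centre
`E_F`, and to the monic generators of the two-sided ideals containing `F(xⁿ)`, so that every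
two-sided ideal of `R_F` is generated by an element of the field `E_F` and `R_F` is simple.
As `R_F` has dimension `n²` over `E_F`, Wedderburn's theorems give `R_F ≅ M_n(E_F)`.

For the rank formula, compute the dimension of `R_F / R_F a` in two ways. It is isomorphic to
`R / R g` with `g = gcrd(a, F(xⁿ))`, which has dimension `n * deg g` over `K`; and the quotient of
`M_n(E)` by the left ideal generated by a matrix of rank `r` has dimension `n * (n - r)` over `E`.
-/

noncomputable section

namespace SkewRank

section SkewPolynomial

open SkewPolynomial Finset.HasAntidiagonal

section Semiring

variable {R : Type*} [Semiring R]

/-- The degree of a skew polynomial over an arbitrary semiring, with value `0` at the zero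
polynomial; over `Twist σ` it is definitionally `natDegree`. -/
def deg (p : SkewPolynomial R) : ℕ := p.support.sup id

theorem le_deg_of_coeff_ne_zero {p : SkewPolynomial R} {k : ℕ} (h : p.coeff k ≠ 0) : k ≤ deg p :=
  Finset.le_sup (f := id) (mem_support_iff.2 h)

theorem coeff_eq_zero_of_deg_lt {p : SkewPolynomial R} {k : ℕ} (h : deg p < k) : p.coeff k = 0 :=
  of_not_not fun hk => h.not_ge (le_deg_of_coeff_ne_zero hk)

theorem deg_le_iff_coeff_eq_zero {p : SkewPolynomial R} {d : ℕ} :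
    deg p ≤ d ↔ ∀ k, d < k → p.coeff k = 0 :=
  ⟨fun h _ hk => coeff_eq_zero_of_deg_lt (h.trans_lt hk), fun h => Finset.sup_le fun k hk =>
    not_lt.1 fun hdk => mem_support_iff.1 hk (h k hdk)⟩

theorem deg_monomial_le (m : ℕ) (a : R) : deg (monomial m a) ≤ m :=
  deg_le_iff_coeff_eq_zero.2 fun _ hk => coeff_monomial.trans (if_neg hk.ne)

theorem coeff_deg_ne_zero {p : SkewPolynomial R} (h : p ≠ 0) : p.coeff (deg p) ≠ 0 := by
  have hne : p.support.Nonempty := Finset.nonempty_iff_ne_empty.2 (mt support_eq_empty.1 h)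
  obtain ⟨k, hk, hdeg⟩ := Finset.exists_mem_eq_sup p.support hne id
  exact mem_support_iff.1 ((show deg p = k from hdeg) ▸ hk)

/-- The coefficient of `x ^ k` as a linear map. -/
def lcoeff (R : Type*) [Semiring R] (k : ℕ) : SkewPolynomial R →ₗ[R] R where
  toFun p := p.coeff k
  map_add' _ _ := coeff_add ..
  map_smul' _ _ := rfl

theorem lcoeff_apply (k : ℕ) (p : SkewPolynomial R) : lcoeff R k p = p.coeff k := rfl

variable (R) in
/-- The left submodule of the skew polynomials whose coefficients vanish from degree `d` on. -/
def degreeLT (d : ℕ) : Submodule R (SkewPolynomial R) :=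
  ⨅ k ≥ d, LinearMap.ker (lcoeff R k)

theorem mem_degreeLT {d : ℕ} {p : SkewPolynomial R} :
    p ∈ degreeLT R d ↔ ∀ k, d ≤ k → p.coeff k = 0 := by
  simp only [degreeLT, Submodule.mem_iInf, LinearMap.mem_ker, lcoeff_apply]

theorem mem_degreeLT_deg_add_one (p : SkewPolynomial R) : p ∈ degreeLT R (deg p + 1) :=
  mem_degreeLT.2 fun _ hk => coeff_eq_zero_of_deg_lt hk

theorem exists_mem_degreeLT_coeff_eq {d : ℕ} (v : Fin d → R) :
    ∃ p ∈ degreeLT R d, ∀ i : Fin d, p.coeff i = v i := by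
  have hcoeff (k : ℕ) :
      (∑ i : Fin d, monomial i (v i)).coeff k = ∑ i : Fin d, if i = k then v i else 0 :=
    (map_sum (lcoeff R k) _ _).trans (Finset.sum_congr rfl fun i _ => coeff_monomial)
  refine ⟨∑ i : Fin d, monomial i (v i), mem_degreeLT.2 fun k hk => ?_, fun j => ?_⟩
  · exact (hcoeff k).trans (Finset.sum_eq_zero fun i _ => if_neg (i.2.trans_le hk).ne)
  · rw [hcoeff]
    simp only [Fin.val_inj, Finset.sum_ite_eq', Finset.mem_univ, if_true]

theorem finrank_degreeLT [StrongRankCondition R] (d : ℕ) :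
    Module.finrank R (degreeLT R d) = d := by
  let f : degreeLT R d →ₗ[R] Fin d → R :=
    LinearMap.pi fun i => lcoeff R i ∘ₗ (degreeLT R d).subtype
  have hinj : Function.Injective f := fun p q hpq => Subtype.ext <| SkewPolynomial.ext fun k => by
    obtain hk | hk := lt_or_ge k d
    · exact congrFun hpq ⟨k, hk⟩
    · rw [mem_degreeLT.1 p.2 k hk, mem_degreeLT.1 q.2 k hk]
  have hsurj : Function.Surjective f := fun v =>
    let ⟨p, hp, hpv⟩ := exists_mem_degreeLT_coeff_eq v
    ⟨⟨p, hp⟩, funext hpv⟩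
  rw [(LinearEquiv.ofBijective f ⟨hinj, hsurj⟩).finrank_eq, Module.finrank_fin_fun]

variable [MulSemiringAction (Multiplicative ℕ) R]

theorem coeff_mul (p q : SkewPolynomial R) (k : ℕ) :
    (p * q).coeff k =
      ∑ ij ∈ antidiagonal k, p.coeff ij.1 * (φ^[ij.1] (q.coeff ij.2)) := by
  simp only [φ_iterate_apply]
  exact SkewMonoidAlgebra.coeff_mul_antidiagonal_of_finset p q (Multiplicative.ofAdd k)
    (antidiagonal (A := ℕ) k) mem_antidiagonal

theorem mul_coeff_zero (p q : SkewPolynomial R) : (p * q).coeff 0 = p.coeff 0 * q.coeff 0 := by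
  rw [coeff_mul, Finset.Nat.antidiagonal_zero, Finset.sum_singleton, Function.iterate_zero_apply]

theorem coeff_monomial_mul (p : SkewPolynomial R) (m k : ℕ) (a : R) :
    (monomial m a * p).coeff (m + k) = a * (φ^[m] (p.coeff k)) := by
  rw [coeff_mul, Finset.sum_eq_single_of_mem (m, k) (mem_antidiagonal.2 rfl)]
  · rw [coeff_monomial, if_pos rfl]
  · intro ij hij hne
    have : m ≠ ij.1 := fun h => hne <| Prod.ext h.symm <| by
      have := mem_antidiagonal.1 hij; omega
    rw [coeff_monomial, if_neg this, zero_mul]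

theorem coeff_mul_monomial (p : SkewPolynomial R) (m k : ℕ) (a : R) :
    (p * monomial m a).coeff (k + m) = p.coeff k * (φ^[k] a) := by
  rw [coeff_mul, Finset.sum_eq_single_of_mem (k, m) (mem_antidiagonal.2 rfl)]
  · rw [coeff_monomial, if_pos rfl]
  · intro ij hij hne
    have : m ≠ ij.2 := fun h => hne <| Prod.ext (by
      have := mem_antidiagonal.1 hij; omega) h.symm
    rw [coeff_monomial, if_neg this, iterate_map_zero, mul_zero]

theorem coeff_C_mul (p : SkewPolynomial R) (k : ℕ) (a : R) :
    (C a * p).coeff k = a * p.coeff k := by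
  conv_lhs => rw [← monomial_zero_left, ← Nat.zero_add k, coeff_monomial_mul]
  rw [Function.iterate_zero_apply]

theorem coeff_mul_C (p : SkewPolynomial R) (k : ℕ) (a : R) :
    (p * C a).coeff k = p.coeff k * (φ^[k] a) :=
  coeff_mul_monomial p 0 k a

theorem coeff_X_mul (p : SkewPolynomial R) (k : ℕ) : (X * p).coeff (k + 1) = φ (p.coeff k) := by
  rw [X, Nat.add_comm, coeff_monomial_mul, one_mul, Function.iterate_one]

theorem coeff_mul_X (p : SkewPolynomial R) (k : ℕ) : (p * X).coeff (k + 1) = p.coeff k := by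
  rw [X, coeff_mul_monomial, iterate_map_one, mul_one]

theorem coeff_mul_of_deg_le {p q : SkewPolynomial R} {m n : ℕ} (hp : deg p ≤ m)
    (hq : deg q ≤ n) : (p * q).coeff (m + n) = p.coeff m * (φ^[m] (q.coeff n)) := by
  rw [coeff_mul, Finset.sum_eq_single_of_mem (m, n) (mem_antidiagonal.2 rfl)]
  intro ij hij hne
  have hsum : ij.1 + ij.2 = m + n := mem_antidiagonal.1 hij
  obtain h | h : m < ij.1 ∨ n < ij.2 := by
    by_contra! h
    exact hne (Prod.ext (by omega) (by omega))
  · rw [coeff_eq_zero_of_deg_lt (hp.trans_lt h), zero_mul]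
  · rw [coeff_eq_zero_of_deg_lt (hq.trans_lt h), iterate_map_zero, mul_zero]

theorem deg_mul_le (p q : SkewPolynomial R) : deg (p * q) ≤ deg p + deg q := by
  refine deg_le_iff_coeff_eq_zero.2 fun k hk => ?_
  rw [show k = deg p + (k - deg p) by omega, coeff_mul_of_deg_le le_rfl (by omega),
    coeff_eq_zero_of_deg_lt (p := q) (by omega), iterate_map_zero, mul_zero]

end Semiring

section DivisionRing

variable {D : Type*} [DivisionRing D] [MulSemiringAction (Multiplicative ℕ) D]

theorem iterate_φ_ne_zero {a : D} (ha : a ≠ 0) (m : ℕ) : (φ^[m] a) ≠ 0 :=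
  (iterate_map_zero (φ : D →+* D) m) ▸ ((φ : D →+* D).injective.iterate m).ne ha

theorem coeff_mul_deg_add_deg_ne_zero {p q : SkewPolynomial D} (hp : p ≠ 0) (hq : q ≠ 0) :
    (p * q).coeff (deg p + deg q) ≠ 0 := by
  rw [coeff_mul_of_deg_le le_rfl le_rfl]
  exact mul_ne_zero (coeff_deg_ne_zero hp) (iterate_φ_ne_zero (coeff_deg_ne_zero hq) _)

instance : NoZeroDivisors (SkewPolynomial D) where
  eq_zero_or_eq_zero_of_mul_eq_zero {p q} h := by
    by_contra! hpq
    exact coeff_mul_deg_add_deg_ne_zero hpq.1 hpq.2 (by rw [h, coeff_zero])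

theorem deg_mul {p q : SkewPolynomial D} (hp : p ≠ 0) (hq : q ≠ 0) :
    deg (p * q) = deg p + deg q :=
  (deg_mul_le p q).antisymm (le_deg_of_coeff_ne_zero (coeff_mul_deg_add_deg_ne_zero hp hq))

theorem exists_sub_monomial_mul_mem_degreeLT {g : SkewPolynomial D} (hg : g ≠ 0) {p} {N : ℕ}
    (hp : p ∈ degreeLT D (N + 1)) (hN : deg g ≤ N) :
    ∃ (m : ℕ) (a : D), p - monomial m a * g ∈ degreeLT D N := by
  obtain ⟨m, rfl⟩ := Nat.exists_eq_add_of_le' hN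
  have hlead := iterate_φ_ne_zero (coeff_deg_ne_zero hg) m
  refine ⟨m, p.coeff (m + deg g) / (φ^[m] (g.coeff (deg g))), mem_degreeLT.2 fun k hk => ?_⟩
  obtain rfl | hk := hk.eq_or_lt
  · rw [coeff_sub, coeff_monomial_mul, div_mul_cancel₀ _ hlead, sub_self]
  · have hdeg : deg (monomial m (p.coeff (m + deg g) / (φ^[m] (g.coeff (deg g)))) * g) < k :=
      ((deg_mul_le _ _).trans (Nat.add_le_add_right (deg_monomial_le ..) _)).trans_lt hk
    rw [coeff_sub, mem_degreeLT.1 hp k hk, coeff_eq_zero_of_deg_lt hdeg, sub_self]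

theorem exists_sub_mem_degreeLT {g : SkewPolynomial D} (hg : g ≠ 0) (p : SkewPolynomial D) :
    ∃ q, p - q * g ∈ degreeLT D (deg g) := by
  suffices ∀ N, ∀ p ∈ degreeLT D N, ∃ q, p - q * g ∈ degreeLT D (deg g) from
    this _ p (mem_degreeLT_deg_add_one p)
  intro N
  induction N with
  | zero =>
    exact fun p hp => ⟨0, by
      rw [zero_mul, sub_zero]
      exact mem_degreeLT.2 fun k _ => mem_degreeLT.1 hp k k.zero_le⟩
  | succ N ih =>
    intro p hp
    obtain hN | hN := le_or_gt (deg g) N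
    · obtain ⟨m, a, hma⟩ := exists_sub_monomial_mul_mem_degreeLT hg hp hN
      obtain ⟨q, hq⟩ := ih _ hma
      exact ⟨monomial m a + q, by rwa [add_mul, ← sub_sub]⟩
    · exact ⟨0, by
        rw [zero_mul, sub_zero]
        exact mem_degreeLT.2 fun k hk => mem_degreeLT.1 hp k (hN.trans_le hk)⟩

theorem isCompl_span_singleton_degreeLT {g : SkewPolynomial D} (hg : g ≠ 0) :
    IsCompl ((Ideal.span {g}).restrictScalars D) (degreeLT D (deg g)) := by
  refine ⟨Submodule.disjoint_def.2 fun p hp hlt => ?_,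
    codisjoint_iff.2 (eq_top_iff.2 fun p _ => ?_)⟩
  · obtain ⟨q, rfl⟩ := Ideal.mem_span_singleton'.1 hp
    by_contra hne
    have hq : q ≠ 0 := left_ne_zero_of_mul hne
    exact coeff_mul_deg_add_deg_ne_zero hq hg (mem_degreeLT.1 hlt _ (Nat.le_add_left ..))
  · obtain ⟨q, hq⟩ := exists_sub_mem_degreeLT hg p
    exact Submodule.mem_sup.2
      ⟨q * g, Ideal.mul_mem_left _ q (Ideal.mem_span_singleton_self g), _, hq, add_sub_cancel ..⟩

theorem finrank_quotient_span_singleton {g : SkewPolynomial D} (hg : g ≠ 0) :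
    Module.finrank D (SkewPolynomial D ⧸ Ideal.span {g}) = deg g := by
  rw [← (Submodule.Quotient.restrictScalarsEquiv D (Ideal.span {g})).finrank_eq,
    (Submodule.quotientEquivOfIsCompl _ _ (isCompl_span_singleton_degreeLT hg)).finrank_eq,
    finrank_degreeLT]

instance : IsPrincipalIdealRing (SkewPolynomial D) where
  principal I := by
    obtain rfl | hI := eq_or_ne I ⊥
    · exact ⟨0, Ideal.span_singleton_zero.symm⟩
    have hex : ∃ d, ∃ p ∈ I, p ≠ 0 ∧ deg p = d :=
      let ⟨p, hp, hne⟩ := Submodule.exists_mem_ne_zero_of_ne_bot hI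
      ⟨_, p, hp, hne, rfl⟩
    classical
    obtain ⟨g, hgI, hg, hdeg⟩ := Nat.find_spec hex
    refine ⟨g, le_antisymm (fun p hp => ?_) ((Ideal.span_singleton_le_iff_mem I).2 hgI)⟩
    obtain ⟨q, hq⟩ := exists_sub_mem_degreeLT hg p
    suffices p - q * g = 0 from Ideal.mem_span_singleton'.2 ⟨q, (sub_eq_zero.1 this).symm⟩
    by_contra hne
    have hlt : deg (p - q * g) < Nat.find hex := hdeg ▸ not_le.1 fun hle =>
      coeff_deg_ne_zero hne (mem_degreeLT.1 hq _ hle)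
    exact Nat.find_min hex hlt ⟨_, I.sub_mem hp (I.mul_mem_left q hgI), hne, rfl⟩

theorem exists_monic_eq_span_singleton {I : Ideal (SkewPolynomial D)} (hI : I ≠ ⊥) :
    ∃ g, I = Ideal.span {g} ∧ g.coeff (deg g) = 1 := by
  obtain ⟨g, rfl⟩ := IsPrincipalIdealRing.principal I
  have hg : g ≠ 0 := fun h => hI (by rw [h]; exact Ideal.span_singleton_zero)
  set c := (g.coeff (deg g))⁻¹
  have hc : c ≠ 0 := inv_ne_zero (coeff_deg_ne_zero hg)
  have hdegC : deg (C c) = 0 := Nat.le_zero.1 (deg_monomial_le 0 c)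
  have hdeg : deg (C c * g) = deg g := by rw [deg_mul (C_eq_zero.not.2 hc) hg, hdegC, zero_add]
  refine ⟨C c * g, (Ideal.span_singleton_mul_left_unit (hc.isUnit.map CRingHom) g).symm, ?_⟩
  rw [hdeg, coeff_C_mul, inv_mul_cancel₀ (coeff_deg_ne_zero hg)]

theorem eq_zero_of_mem_span_of_coeff_zero_eq_zero {b h : SkewPolynomial D} (hb : b.coeff 0 ≠ 0)
    (hmem : h ∈ Ideal.span {b}) (hdeg : deg h ≤ deg b) (h₀ : h.coeff 0 = 0) : h = 0 := by
  obtain ⟨c, rfl⟩ := Ideal.mem_span_singleton'.1 hmem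
  by_contra hne
  have hc : c ≠ 0 := left_ne_zero_of_mul hne
  have hdegc : deg c = 0 := by
    rw [deg_mul hc (right_ne_zero_of_mul hne)] at hdeg
    omega
  rw [mul_coeff_zero, ← hdegc] at h₀
  exact mul_ne_zero (coeff_deg_ne_zero hc) (hdegc ▸ hb) (hdegc ▸ h₀)

end DivisionRing

end SkewPolynomial

section MatrixAlgebra

theorem mem_span_singleton_iff_forall_row_mem {E ι : Type*} [CommRing E] [Fintype ι]
    [DecidableEq ι] {A B : Matrix ι ι E} :
    A ∈ Ideal.span {B} ↔ ∀ i, A i ∈ Submodule.span E (Set.range B.row) := by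
  rw [← range_vecMulLinear, Ideal.mem_span_singleton']
  constructor
  · rintro ⟨C, rfl⟩ i
    exact ⟨C i, (Matrix.mul_apply_eq_vecMul C B i).symm⟩
  · intro h
    choose C hC using h
    exact ⟨Matrix.of C, funext fun i => (Matrix.mul_apply_eq_vecMul _ B i).trans (hC i)⟩

theorem finrank_matrix_quotient_span_singleton_add {E ι : Type*} [Field E] [Fintype ι]
    [DecidableEq ι] (B : Matrix ι ι E) :
    Module.finrank E (Matrix ι ι E ⧸ Ideal.span {B}) + Fintype.card ι * B.rank =
      Fintype.card ι * Fintype.card ι := by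
  set W := Submodule.span E (Set.range B.row)
  let I : Submodule E (ι → ι → E) := (Ideal.span {B}).restrictScalars E
  have hI : I = Submodule.pi Set.univ fun _ => W := Submodule.ext fun A =>
    mem_span_singleton_iff_forall_row_mem.trans
      (Submodule.mem_pi.trans (forall_congr' fun _ => forall_prop_of_true trivial)).symm
  have hquot : Module.finrank E (Matrix ι ι E ⧸ Ideal.span {B}) =
      Fintype.card ι * Module.finrank E ((ι → E) ⧸ W) := calc
    _ = Module.finrank E ((ι → ι → E) ⧸ I) :=
      (Submodule.Quotient.restrictScalarsEquiv E (Ideal.span {B})).finrank_eq.symm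
    _ = Module.finrank E (ι → (ι → E) ⧸ W) := by
      rw [hI, (Submodule.quotientPi fun _ => W).finrank_eq]
    _ = _ := by
      rw [Module.finrank_pi_fintype, Finset.sum_const, Finset.card_univ, smul_eq_mul]
  rw [hquot, B.rank_eq_finrank_span_row, ← mul_add, W.finrank_quotient_add_finrank,
    Module.finrank_pi]

theorem finrank_quotient_span_singleton_algEquiv {E A B : Type*} [CommRing E] [Ring A] [Ring B]
    [Algebra E A] [Algebra E B] (e : A ≃ₐ[E] B) (r : A) :
    Module.finrank E (B ⧸ Ideal.span {e r}) = Module.finrank E (A ⧸ Ideal.span {r}) := by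
  have hmap : ((Ideal.span {r}).restrictScalars E).map e.toLinearMap =
      (Ideal.span {e r}).restrictScalars E := by
    ext b
    simp only [Submodule.mem_map, Submodule.restrictScalars_mem, Ideal.mem_span_singleton']
    constructor
    · rintro ⟨_, ⟨c, rfl⟩, rfl⟩
      exact ⟨e c, (map_mul e c r).symm⟩
    · rintro ⟨c, rfl⟩
      exact ⟨e.symm c * r, ⟨_, rfl⟩, by simp⟩
  exact ((Submodule.Quotient.restrictScalarsEquiv E _).symm.trans
    ((Submodule.Quotient.equiv _ _ e.toLinearEquiv hmap).symm.trans
      (Submodule.Quotient.restrictScalarsEquiv E _))).finrank_eq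

theorem isCentral_of_isCentral_matrix {E D ι : Type*} [CommRing E] [Ring D] [Algebra E D]
    [Fintype ι] [DecidableEq ι] [Nonempty ι] [Algebra.IsCentral E (Matrix ι ι D)] :
    Algebra.IsCentral E D where
  out d hd := by
    have hmem : Matrix.scalar ι d ∈ Subalgebra.center E (Matrix ι ι D) := by
      rw [Matrix.subalgebraCenter_eq_scalarAlgHom_map]
      exact ⟨d, hd, rfl⟩
    obtain ⟨c, hc⟩ := Algebra.IsCentral.out hmem
    exact ⟨c, Matrix.scalar_inj.1 hc⟩

theorem nonempty_algEquiv_matrix_of_finite {E A ι : Type*} [Field E] [Finite E] [Ring A]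
    [Algebra E A] [Algebra.IsCentral E A] [IsSimpleRing A] [Module.Finite E A] [Fintype ι]
    [DecidableEq ι] (hι : Module.finrank E A = Fintype.card ι * Fintype.card ι) :
    Nonempty (A ≃ₐ[E] Matrix ι ι E) := by
  have : IsArtinianRing A := IsArtinianRing.of_finite E A
  obtain ⟨m, _, D, _, _, _, ⟨f⟩⟩ := IsSimpleRing.exists_algEquiv_matrix_divisionRing_finite E A
  have : Finite D := Module.finite_of_finite E
  have : Algebra.IsCentral E (Matrix (Fin m) (Fin m) D) := .of_algEquiv E A _ f
  have : Algebra.IsCentral E D := isCentral_of_isCentral_matrix (ι := Fin m)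
  have hbij : Function.Bijective (algebraMap E D) := by
    rw [Algebra.bijective_algebraMap_iff, ← Algebra.IsCentral.center_eq_bot E D,
      Subalgebra.center_eq_top]
  let f' : A ≃ₐ[E] Matrix (Fin m) (Fin m) E :=
    f.trans (AlgEquiv.ofBijective (Algebra.ofId E D) hbij).symm.mapMatrix
  have hm : Fintype.card ι * Fintype.card ι = m * m := by
    rw [← hι, f'.toLinearEquiv.finrank_eq, Module.finrank_matrix, Module.finrank_self,
      Fintype.card_fin, mul_one]
  have e : Fin m ≃ ι := Fintype.equivOfCardEq <| by
    rw [Fintype.card_fin, Nat.mul_self_inj.1 hm]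
  exact ⟨f'.trans (Matrix.reindexAlgEquiv E E e)⟩

end MatrixAlgebra

section Central

variable {K L : Type*} [Field K] [Field L] [Algebra K L] {σ : L ≃ₐ[K] L} {F : Polynomial K}

theorem iterate_φ_apply (m : ℕ) (a : Twist σ) : (SkewPolynomial.φ^[m] a) = (σ ^ m) a :=
  SkewPolynomial.φ_iterate_apply m a

theorem central_monomial (j : ℕ) (c : K) :
    central σ (Polynomial.monomial j c) =
      SkewPolynomial.monomial (orderOf σ * j) (algebraMap K (Twist σ) c) := by
  rw [central, Polynomial.aeval_monomial, ← pow_mul, ← SkewPolynomial.C_mul_X_pow_eq_monomial]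
  rfl

theorem coeff_central (hσ : 0 < orderOf σ) (F : Polynomial K) (k : ℕ) :
    (central σ F).coeff k =
      if orderOf σ ∣ k then algebraMap K (Twist σ) (F.coeff (k / orderOf σ)) else 0 := by
  induction F using Polynomial.induction_on' with
  | add F G hF hG =>
    rw [show central σ (F + G) = central σ F + central σ G from map_add _ F G,
      SkewPolynomial.coeff_add, hF, hG, Polynomial.coeff_add, map_add, ite_add_ite, add_zero]
  | monomial j c =>
    rw [central_monomial, SkewPolynomial.coeff_monomial, Polynomial.coeff_monomial]
    by_cases hk : orderOf σ ∣ k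
    · obtain ⟨i, rfl⟩ := hk
      rw [if_pos (dvd_mul_right ..), Nat.mul_div_cancel_left _ hσ, apply_ite (algebraMap K _),
        map_zero, if_congr (Nat.mul_right_inj hσ.ne') rfl rfl]
    · rw [if_neg hk, if_neg fun h => hk ⟨j, h.symm⟩]

theorem coeff_zero_central (hσ : 0 < orderOf σ) (F : Polynomial K) :
    (central σ F).coeff 0 = algebraMap K (Twist σ) (F.coeff 0) := by
  rw [coeff_central hσ, if_pos (dvd_zero _), Nat.zero_div]

theorem deg_central (hσ : 0 < orderOf σ) (F : Polynomial K) :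
    deg (central σ F) = orderOf σ * F.natDegree := by
  obtain rfl | hF := eq_or_ne F 0
  · simp [central, deg]
  refine le_antisymm (deg_le_iff_coeff_eq_zero.2 fun k hk => ?_) (le_deg_of_coeff_ne_zero ?_)
  · rw [coeff_central hσ, ite_eq_right_iff]
    rintro ⟨j, rfl⟩
    rw [Nat.mul_div_cancel_left _ hσ, Polynomial.coeff_eq_zero_of_natDegree_lt
      (Nat.lt_of_mul_lt_mul_left hk), map_zero]
  · rw [coeff_central hσ, if_pos (dvd_mul_right ..), Nat.mul_div_cancel_left _ hσ]
    exact (map_ne_zero _).2 (Polynomial.leadingCoeff_ne_zero.2 hF)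

theorem central_ne_zero (hσ : 0 < orderOf σ) (hF : F ≠ 0) : central σ F ≠ 0 := fun h => by
  have := coeff_central hσ F (orderOf σ * F.natDegree)
  rw [h, SkewPolynomial.coeff_zero, if_pos (dvd_mul_right ..), Nat.mul_div_cancel_left _ hσ] at this
  exact (map_ne_zero _).2 (Polynomial.leadingCoeff_ne_zero.2 hF) this.symm

theorem exists_central_eq_of_commute (hfix : ∀ a, σ a = a → a ∈ Set.range (algebraMap K L))
    {p : SkewPoly σ} (hC : ∀ a, Commute p (SkewPolynomial.C a))
    (hX : Commute p SkewPolynomial.X) : ∃ G, central σ G = p := by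
  have hcoeff_C (k : ℕ) (a : Twist σ) :
      p.coeff k * (SkewPolynomial.φ^[k] a) = a * p.coeff k := by
    rw [← coeff_mul_C, (hC a).eq, coeff_C_mul]
  have hcoeff_X (k : ℕ) : SkewPolynomial.φ (p.coeff k) = p.coeff k := by
    rw [← coeff_X_mul, ← hX.eq, coeff_mul_X]
  change p ∈ (Polynomial.aeval ((SkewPolynomial.X : SkewPoly σ) ^ orderOf σ)).range
  rw [← p.sum_monomial, SkewPolynomial.sum_def]
  refine sum_mem fun k hk => ?_
  have hpk : p.coeff k ≠ 0 := SkewPolynomial.mem_support_iff.1 hk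
  have hpow : σ ^ k = 1 := AlgEquiv.ext fun a =>
    (iterate_φ_apply k a).symm.trans
      (mul_left_cancel₀ hpk ((hcoeff_C k a).trans (mul_comm a (p.coeff k))))
  obtain ⟨j, rfl⟩ := orderOf_dvd_of_pow_eq_one hpow
  obtain ⟨c, hc⟩ := hfix _ ((iterate_φ_apply 1 _).symm.trans (hcoeff_X (orderOf σ * j)))
  exact ⟨Polynomial.monomial j c, (central_monomial j c).trans (congrArg _ hc)⟩

theorem deg_commutator_C_le (p : SkewPoly σ) (a : Twist σ) :
    deg (p * SkewPolynomial.C a - SkewPolynomial.C a * p) ≤ deg p :=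
  deg_le_iff_coeff_eq_zero.2 fun k hk => by
    rw [SkewPolynomial.coeff_sub, coeff_mul_C, coeff_C_mul, coeff_eq_zero_of_deg_lt hk, zero_mul,
      mul_zero, sub_zero]

theorem deg_commutator_X_le {p : SkewPoly σ} {d : ℕ} (hp : deg p ≤ d)
    (hd : SkewPolynomial.φ (p.coeff d) = p.coeff d) :
    deg (p * SkewPolynomial.X - SkewPolynomial.X * p) ≤ d := by
  refine deg_le_iff_coeff_eq_zero.2 fun k hk => ?_
  obtain ⟨k, rfl⟩ := Nat.exists_eq_add_of_le' (Nat.one_le_of_lt hk)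
  rw [SkewPolynomial.coeff_sub, coeff_mul_X, coeff_X_mul]
  obtain rfl | hlt := (Nat.lt_succ_iff.1 hk).eq_or_lt
  · rw [hd, sub_self]
  · rw [coeff_eq_zero_of_deg_lt (hp.trans_lt hlt), map_zero, sub_zero]

theorem exists_central_eq_of_commutator_mem
    (hfix : ∀ a, σ a = a → a ∈ Set.range (algebraMap K L)) {b p : SkewPoly σ}
    (hb : b.coeff 0 ≠ 0) (hdeg : deg p ≤ deg b)
    (hlead : SkewPolynomial.φ (p.coeff (deg b)) = p.coeff (deg b))
    (hcomm : ∀ q, p * q - q * p ∈ Ideal.span {b}) : ∃ G, central σ G = p := by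
  refine exists_central_eq_of_commute hfix (fun a => sub_eq_zero.1 ?_) (sub_eq_zero.1 ?_)
  · refine eq_zero_of_mem_span_of_coeff_zero_eq_zero hb (hcomm _)
      ((deg_commutator_C_le p a).trans hdeg) ?_
    rw [SkewPolynomial.coeff_sub, mul_coeff_zero, mul_coeff_zero, mul_comm, sub_self]
  · refine eq_zero_of_mem_span_of_coeff_zero_eq_zero hb (hcomm _)
      (deg_commutator_X_le hdeg hlead) ?_
    rw [SkewPolynomial.coeff_sub, mul_coeff_zero, mul_coeff_zero, SkewPolynomial.coeff_X_zero,
      mul_zero, zero_mul, sub_self]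

end Central

section Quotient

variable {K L : Type*} [Field K] [Field L] [Algebra K L] {σ : L ≃ₐ[K] L} {F : Polynomial K}

theorem mk_surjective : Function.Surjective (RF.mk σ F) := Ideal.Quotient.mk_surjective

theorem mk_eq_zero_iff_mem {p : SkewPoly σ} : RF.mk σ F p = 0 ↔ p ∈ Ideal.span {central σ F} :=
  Ideal.Quotient.eq_zero_iff_mem

theorem mk_central (G : Polynomial K) :
    RF.mk σ F (central σ G) = algebraMap (AdjoinRoot F) (RF σ F) (AdjoinRoot.mk F G) := rfl

theorem mk_commute_iff {p q : SkewPoly σ} :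
    Commute (RF.mk σ F p) (RF.mk σ F q) ↔ p * q - q * p ∈ Ideal.span {central σ F} := by
  rw [← mk_eq_zero_iff_mem, map_sub, map_mul, map_mul, sub_eq_zero, Commute, SemiconjBy]

theorem isCentral_RF (hσ : 0 < orderOf σ) (hfix : ∀ a, σ a = a → a ∈ Set.range (algebraMap K L))
    (hF₀ : F.coeff 0 ≠ 0) : Algebra.IsCentral (AdjoinRoot F) (RF σ F) where
  out z hz := by
    have hF : F ≠ 0 := fun h => hF₀ (by rw [h, Polynomial.coeff_zero])
    obtain ⟨p, rfl⟩ := mk_surjective z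
    obtain ⟨q, hq⟩ := exists_sub_mem_degreeLT (central_ne_zero hσ hF) p
    set r := p - q * central σ F
    have hr : RF.mk σ F r = RF.mk σ F p := by
      rw [map_sub, map_mul, mk_eq_zero_iff_mem.2 (Ideal.mem_span_singleton_self _), mul_zero,
        sub_zero]
    have hrdeg : deg r ≤ deg (central σ F) :=
      deg_le_iff_coeff_eq_zero.2 fun k hk => mem_degreeLT.1 hq k hk.le
    have hrlead : r.coeff (deg (central σ F)) = 0 := mem_degreeLT.1 hq _ le_rfl
    obtain ⟨G, hG⟩ := exists_central_eq_of_commutator_mem hfix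
      (by rwa [coeff_zero_central hσ, map_ne_zero]) hrdeg (by rw [hrlead, map_zero]) fun s =>
        mk_commute_iff.1 (hr ▸ (Subalgebra.mem_center_iff.1 hz (RF.mk σ F s)).symm)
    exact ⟨AdjoinRoot.mk F G, (mk_central G).symm.trans ((congrArg _ hG).trans hr)⟩

theorem nontrivial_RF (hσ : 0 < orderOf σ) (hF : 0 < F.natDegree) : Nontrivial (RF σ F) :=
  Module.nontrivial_of_finrank_pos (R := Twist σ)
    (M := SkewPoly σ ⧸ Ideal.span {central σ F}) <| by
    rw [finrank_quotient_span_singleton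
      (central_ne_zero hσ (Polynomial.ne_zero_of_natDegree_gt hF)), deg_central hσ]
    exact Nat.mul_pos hσ hF

theorem exists_central_of_isTwoSided (hσ : 0 < orderOf σ)
    (hfix : ∀ a, σ a = a → a ∈ Set.range (algebraMap K L)) (hF₀ : F.coeff 0 ≠ 0)
    (J : Ideal (SkewPoly σ)) [J.IsTwoSided] (hF : central σ F ∈ J) :
    ∃ G, J = Ideal.span {central σ G} := by
  have hcF₀ : (central σ F).coeff 0 ≠ 0 := by rwa [coeff_zero_central hσ, map_ne_zero]
  have hJ : J ≠ ⊥ := fun h => hcF₀ <| by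
    rw [show central σ F = 0 from (Submodule.mem_bot _).1 (h ▸ hF), SkewPolynomial.coeff_zero]
  obtain ⟨g, rfl, hg⟩ := exists_monic_eq_span_singleton hJ
  have hg₀ : g.coeff 0 ≠ 0 := by
    obtain ⟨c, hc⟩ := Ideal.mem_span_singleton'.1 hF
    rw [← hc, mul_coeff_zero] at hcF₀
    exact right_ne_zero_of_mul hcF₀
  have hgJ := Ideal.mem_span_singleton_self g
  obtain ⟨G, rfl⟩ := exists_central_eq_of_commutator_mem hfix hg₀ le_rfl (by rw [hg, map_one])
    fun q => sub_mem (Ideal.mul_mem_right q _ hgJ) (Ideal.mul_mem_left _ q hgJ)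
  exact ⟨G, rfl⟩

theorem isSimpleRing_RF [Fact (Irreducible F)] (hσ : 0 < orderOf σ)
    (hfix : ∀ a, σ a = a → a ∈ Set.range (algebraMap K L)) (hF₀ : F.coeff 0 ≠ 0) :
    IsSimpleRing (RF σ F) := by
  refine isSimpleRing_iff_isTwoSided_imp.2
    ⟨nontrivial_RF hσ (Fact.out : Irreducible F).natDegree_pos, fun I _ => ?_⟩
  have hmem : central σ F ∈ I.comap (RF.mk σ F) := by
    rw [Ideal.mem_comap, mk_eq_zero_iff_mem.2 (Ideal.mem_span_singleton_self _)]
    exact I.zero_mem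
  obtain ⟨G, hG⟩ := exists_central_of_isTwoSided hσ hfix hF₀ _ hmem
  have hI : I = Ideal.span {algebraMap (AdjoinRoot F) (RF σ F) (AdjoinRoot.mk F G)} := by
    rw [← mk_central, ← Set.image_singleton, ← Ideal.map_span, ← hG,
      Ideal.map_comap_of_surjective _ mk_surjective]
  rw [hI]
  obtain h | h := eq_or_ne (AdjoinRoot.mk F G) 0
  · exact .inl (by rw [h, map_zero, Ideal.span_singleton_zero])
  · exact .inr (Ideal.eq_top_of_isUnit_mem _ (Ideal.mem_span_singleton_self _) (h.isUnit.map _))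

end Quotient

section Dimension

variable {K L : Type*} [Field K] [Field L] [Algebra K L] {σ : L ≃ₐ[K] L} {F : Polynomial K}

theorem isGCRD_iff_span_eq {g a b : SkewPoly σ} :
    IsGCRD g a b ↔ Ideal.span {a, b} = Ideal.span {g} := by
  have hdvd (p q : SkewPoly σ) : (∃ c, p = c * q) ↔ p ∈ Ideal.span {q} := by
    simp only [Ideal.mem_span_singleton', eq_comm]
  have hle (q : SkewPoly σ) :
      Ideal.span {a, b} ≤ Ideal.span {q} ↔ a ∈ Ideal.span {q} ∧ b ∈ Ideal.span {q} := by
    rw [Ideal.span_le, Set.pair_subset_iff, SetLike.mem_coe, SetLike.mem_coe]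
  simp only [IsGCRD, hdvd]
  constructor
  · rintro ⟨ha, hb, hmax⟩
    refine le_antisymm ((hle g).2 ⟨ha, hb⟩) ((Ideal.span_singleton_le_iff_mem _).2 ?_)
    obtain ⟨d, hd⟩ := IsPrincipalIdealRing.principal (Ideal.span {a, b})
    obtain ⟨had, hbd⟩ := (hle d).1 hd.le
    exact hd ▸ hmax d had hbd
  · intro h
    obtain ⟨ha, hb⟩ := (hle g).1 h.le
    exact ⟨ha, hb, fun d had hbd => (hle d).2 ⟨had, hbd⟩ (h ▸ Ideal.mem_span_singleton_self g)⟩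

theorem exists_isGCRD (a b : SkewPoly σ) : ∃ g, IsGCRD g a b :=
  let ⟨g, hg⟩ := IsPrincipalIdealRing.principal (Ideal.span {a, b})
  ⟨g, isGCRD_iff_span_eq.2 hg⟩

theorem IsGCRD.ne_zero {g a b : SkewPoly σ} (h : IsGCRD g a b) (hb : b ≠ 0) : g ≠ 0 := fun hg =>
  let ⟨c, hc⟩ := h.2.1
  hb (by rw [hc, hg, mul_zero])

theorem mk_mem_span_mk_iff {p a g : SkewPoly σ} (h : IsGCRD g a (central σ F)) :
    RF.mk σ F p ∈ Ideal.span {RF.mk σ F a} ↔ p ∈ Ideal.span {g} := by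
  have hker : (⊥ : Ideal (RF σ F)).comap (RF.mk σ F) = Ideal.span {central σ F} :=
    Ideal.ext fun _ => mk_eq_zero_iff_mem
  rw [← Set.image_singleton, ← Ideal.map_span, ← Ideal.mem_comap,
    Ideal.comap_map_of_surjective _ mk_surjective, hker, ← Ideal.span_insert,
    isGCRD_iff_span_eq.1 h]

instance : Algebra K (RF σ F) := Algebra.compHom _ (algebraMap K (AdjoinRoot F))

instance : IsScalarTower K (AdjoinRoot F) (RF σ F) := .of_algebraMap_eq fun _ => rfl

variable (σ F) in
/-- The residue map `R → R_F` as a homomorphism of `K`-algebras. -/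
def mkₐ : SkewPoly σ →ₐ[K] RF σ F where
  __ := RF.mk σ F
  commutes' c := congrArg (RF.mk σ F) (Polynomial.aeval_C _ c).symm

theorem finrank_eq_finrank_mul_deg {M : Type*} [AddCommGroup M] [Module K M] {g : SkewPoly σ}
    (hg : g ≠ 0) (f : SkewPoly σ →ₗ[K] M) (hf : Function.Surjective f)
    (hker : ∀ p, f p = 0 ↔ p ∈ Ideal.span {g}) :
    Module.finrank K M = Module.finrank K L * deg g := by
  have hker : LinearMap.ker f = (Ideal.span {g}).restrictScalars K := Submodule.ext hker
  have e : M ≃ₗ[K] (SkewPoly σ ⧸ Ideal.span {g}) :=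
    (f.quotKerEquivOfSurjective hf).symm.trans <|
      (Submodule.quotEquivOfEq _ _ hker).trans (Submodule.Quotient.restrictScalarsEquiv K _)
  have : Module.Free (Twist σ) (SkewPoly σ ⧸ Ideal.span {g}) := Module.Free.of_divisionRing _ _
  rw [e.finrank_eq, ← Module.finrank_mul_finrank K (Twist σ), finrank_quotient_span_singleton hg]
  rfl

theorem finrank_adjoinRoot_mul_finrank [Fact (Irreducible F)] (M : Type*) [AddCommGroup M]
    [Module K M] [Module (AdjoinRoot F) M] [IsScalarTower K (AdjoinRoot F) M] :
    F.natDegree * Module.finrank (AdjoinRoot F) M = Module.finrank K M := by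
  have hF : F ≠ 0 := (Fact.out : Irreducible F).ne_zero
  rw [← Module.finrank_mul_finrank K (AdjoinRoot F) M, (AdjoinRoot.powerBasis hF).finrank,
    AdjoinRoot.powerBasis_dim]

theorem finrank_RF [Fact (Irreducible F)] (hσ : 0 < orderOf σ) :
    Module.finrank (AdjoinRoot F) (RF σ F) = Module.finrank K L * orderOf σ := by
  have hF : Irreducible F := Fact.out
  refine Nat.eq_of_mul_eq_mul_left hF.natDegree_pos ?_
  rw [finrank_adjoinRoot_mul_finrank, finrank_eq_finrank_mul_deg (central_ne_zero hσ hF.ne_zero)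
    (mkₐ σ F).toLinearMap mk_surjective fun _ => mk_eq_zero_iff_mem, deg_central hσ, ← mul_assoc,
    mul_comm]

theorem finrank_RF_quotient_span_mk [Fact (Irreducible F)] (hσ : 0 < orderOf σ)
    {a g : SkewPoly σ} (h : IsGCRD g a (central σ F)) :
    F.natDegree * Module.finrank (AdjoinRoot F) (RF σ F ⧸ Ideal.span {RF.mk σ F a}) =
      Module.finrank K L * deg g := by
  have hg : g ≠ 0 := h.ne_zero (central_ne_zero hσ (Fact.out : Irreducible F).ne_zero)
  let π : RF σ F →ₗ[K] RF σ F ⧸ Ideal.span {RF.mk σ F a} :=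
    (Ideal.span {RF.mk σ F a}).mkQ.restrictScalars K
  rw [finrank_adjoinRoot_mul_finrank]
  exact finrank_eq_finrank_mul_deg hg (π ∘ₗ (mkₐ σ F).toLinearMap)
    ((Submodule.mkQ_surjective _).comp mk_surjective) fun p =>
      (Submodule.Quotient.mk_eq_zero _).trans (mk_mem_span_mk_iff h)

end Dimension

section Main

variable {K L : Type*} [Field K] [Field L] [Algebra K L] {σ : L ≃ₐ[K] L} {F : Polynomial K}
  {ι : Type*} [Fintype ι] [DecidableEq ι]

theorem coeff_zero_ne_zero_of_irreducible_of_ne_X (hF : F.Monic) (hirr : Irreducible F)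
    (hX : F ≠ Polynomial.X) : F.coeff 0 ≠ 0 := fun h =>
  have hdvd : Polynomial.X ∣ F := Polynomial.X_dvd_iff.2 h
  hX (Polynomial.eq_of_monic_of_associated Polynomial.monic_X hF
    (Polynomial.irreducible_X.associated_of_dvd hirr hdvd)).symm

theorem mem_range_algebraMap_of_apply_eq [FiniteDimensional K L] [IsGalois K L]
    (hσ : ∀ τ : L ≃ₐ[K] L, τ ∈ Subgroup.zpowers σ) (a : L) (ha : σ a = a) :
    a ∈ Set.range (algebraMap K L) := by
  have hle : Subgroup.zpowers σ ≤ MulAction.stabilizer (L ≃ₐ[K] L) a :=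
    Subgroup.zpowers_le.2 ha
  exact (IsGalois.mem_range_algebraMap_iff_fixed a).2 fun τ => hle (hσ τ)

theorem orderOf_eq_finrank [FiniteDimensional K L] [IsGalois K L]
    (hσ : ∀ τ : L ≃ₐ[K] L, τ ∈ Subgroup.zpowers σ) : orderOf σ = Module.finrank K L := by
  rw [orderOf_eq_card_of_forall_mem_zpowers hσ, IsGalois.card_aut_eq_finrank]

theorem nonempty_RF_algEquiv_matrix [Finite K] [FiniteDimensional K L] [IsGalois K L]
    [Fact (Irreducible F)] (hσ : ∀ τ : L ≃ₐ[K] L, τ ∈ Subgroup.zpowers σ) (hF₀ : F.coeff 0 ≠ 0)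
    (hι : Fintype.card ι = Module.finrank K L) :
    Nonempty (RF σ F ≃ₐ[AdjoinRoot F] Matrix ι ι (AdjoinRoot F)) := by
  have hfix := mem_range_algebraMap_of_apply_eq hσ
  have hdim : Module.finrank (AdjoinRoot F) (RF σ F) = Fintype.card ι * Fintype.card ι := by
    rw [finrank_RF (orderOf_pos σ), orderOf_eq_finrank hσ, hι]
  have hpos : 0 < Fintype.card ι := hι ▸ Module.finrank_pos
  have : Module.Finite K (AdjoinRoot F) :=
    (AdjoinRoot.powerBasis (Fact.out : Irreducible F).ne_zero).finite
  have : Finite (AdjoinRoot F) := Module.finite_of_finite K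
  have : Module.Finite (AdjoinRoot F) (RF σ F) :=
    Module.finite_of_finrank_pos (hdim ▸ Nat.mul_pos hpos hpos)
  have := isCentral_RF (orderOf_pos σ) hfix hF₀
  have := isSimpleRing_RF (orderOf_pos σ) hfix hF₀
  exact nonempty_algEquiv_matrix_of_finite hdim

theorem deg_add_natDegree_mul_rank [FiniteDimensional K L] [Fact (Irreducible F)]
    (hι : Fintype.card ι = Module.finrank K L)
    (e : RF σ F ≃ₐ[AdjoinRoot F] Matrix ι ι (AdjoinRoot F)) {a g : SkewPoly σ}
    (h : IsGCRD g a (central σ F)) :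
    deg g + F.natDegree * (e (RF.mk σ F a)).rank = F.natDegree * Fintype.card ι := by
  have hpos : 0 < Fintype.card ι := hι ▸ Module.finrank_pos
  refine Nat.eq_of_mul_eq_mul_left hpos ?_
  have hrank := finrank_matrix_quotient_span_singleton_add (e (RF.mk σ F a))
  have hdeg := finrank_RF_quotient_span_mk (orderOf_pos σ) h
  rw [← finrank_quotient_span_singleton_algEquiv e, ← hι] at hdeg
  rw [mul_add, ← hdeg, mul_left_comm, ← mul_add, hrank, mul_left_comm]

end Main

end SkewRank

end

theorem mainTheorem2 {K L : Type*} [Field K] [Field L] [Algebra K L]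
    [FiniteDimensional K L] [IsGalois K L]
    (σ : L ≃ₐ[K] L) (hσ : ∀ τ : L ≃ₐ[K] L, τ ∈ Subgroup.zpowers σ)
    (n : ℕ) (hn : Module.finrank K L = n)
    (F : Polynomial K) (hmonic : F.Monic) (hirr : Irreducible F)
    (s : ℕ) (hs : F.natDegree = s) :
    -- for finite `K` and `F ≠ y` the algebra `R_F` is a full matrix algebra over `E_F`
    (Finite K → F ≠ Polynomial.X →
      Nonempty (SkewRank.RF σ F ≃ₐ[AdjoinRoot F] Matrix (Fin n) (Fin n) (AdjoinRoot F))) ∧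
    -- greatest common right divisors exist
    (∀ a : SkewRank.SkewPoly σ, ∃ g, SkewRank.IsGCRD g a (SkewRank.central σ F)) ∧
    -- the rank formula, for every identification of `R_F` with the matrix algebra
    (∀ (e : SkewRank.RF σ F ≃ₐ[AdjoinRoot F] Matrix (Fin n) (Fin n) (AdjoinRoot F))
      (a g : SkewRank.SkewPoly σ), SkewRank.IsGCRD g a (SkewRank.central σ F) →
        ((e (SkewRank.RF.mk σ F a)).rank : ℚ) =
          (n : ℚ) - (1 / (s : ℚ)) * (SkewRank.natDegree g : ℚ)) := by
  have := Fact.mk hirr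
  have hι : Fintype.card (Fin n) = Module.finrank K L := by rw [Fintype.card_fin, hn]
  refine ⟨fun _ hX => ?_, fun a => SkewRank.exists_isGCRD a _, fun e a g hg => ?_⟩
  · have hF₀ := SkewRank.coeff_zero_ne_zero_of_irreducible_of_ne_X hmonic hirr hX
    exact SkewRank.nonempty_RF_algEquiv_matrix hσ hF₀ hι
  · have hs₀ : (s : ℚ) ≠ 0 := Nat.cast_ne_zero.2 (hs ▸ hirr.natDegree_pos.ne')
    have hrank : SkewRank.natDegree g + s * (e (SkewRank.RF.mk σ F a)).rank = s * n := by
      have := SkewRank.deg_add_natDegree_mul_rank hι e hg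
      rwa [hs, Fintype.card_fin] at this
    have hrankℚ : (SkewRank.natDegree g : ℚ) + s * (e (SkewRank.RF.mk σ F a)).rank = s * n := by
      exact_mod_cast hrank
    field_simp
    linarith
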